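/- Let $L$ be a frame. An $L$-subset of $X$ is a map $A:X\to L$, and $\mathrm{sub}(A,B)=\bigwedge_{x}A(x)\to B(x)$. An $L$-ordered set is a set $P$ with a map $e:P\times P\to L$ such that $e(x,x)=1$, $e(x,y)\wedge e(y,z)\le e(x,z)$, and $e(x,y)\wedge e(y,x)=1$ implies $x=y$. An element $x$ is the supremum $\sqcup A$ of $A\in L^P$ if $e(x,y)=\mathrm{sub}(A,e(-,y))$ for all $y$. An $L$-subset $D\in L^P$ is directed if $\bigvee_x D(x)=1$ and $D(x)\wedge D(y)\le\bigvee_z D(z)\wedge e(x,z)\wedge e(y,z)$ for all $x,y$. $P$ is an $L$-dcpo if all directed $L$-subsets have suprema. Let $\mathcal D^*(P)$ be the set of directed $L$-subsets of $P$ that have a supremum. $P$ is continuous if for every $x$ the $L$-subset $\Downarrow x$, $\Downarrow x(y)=\bigwedge_{D\in\mathcal D^*(P)}\bigl(e(x,\sqcup D)\to\bigvee_d D(d)\wedge e(y,d)\bigr)$, is directed with supremum $x$. A map $f:P\to Q$ of $L$-ordered sets is Scott continuous if for every $D\in\mathcal D^*(P)$ the $L$-subset $f^\to(D)$, $f^{\to}(D)(q)=\bigvee_{f(x)=q}D(x)$,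 has supremum $f(\sqcup D)$. An $L$-topology on $X$ is a family $\mathcal O(X)\subseteq L^X$ closed under binary meets and arbitrary joins and containing all constant maps; $f:X\to Y$ is continuous if $B\circ f\in\mathcal O(X)$ for all $B\in\mathcal O(Y)$. $X$ is $T_0$ if $A(x)=A(y)$ for all $A\in\mathcal O(X)$ implies $x=y$. A point of $\mathcal O(X)$ is a map $p:\mathcal O(X)\to L$ that preserves binary meets and arbitrary joins and sends the constant map with value $a$ to $a$ for every $a\in L$. $X$ is $L$-sober if $x\mapsto[x]$, $[x](A)=A(x)$, is a bijection from $X$ onto the set of points of $\mathcal O(X)$; $L$-sober spaces are $T_0$. $X$ is locally super-compact if every $A\in\mathcal O(X)$ equals $\bigvee_B \mathrm{sub}(B,A)\wedge B^\circ$, where $B^\circ$ is the largest open $L$-subset below $B$ and $B$ runs over the $L$-subsets with $\bigvee_x B(x)=1$ and $\mathrm{sub}(B,\bigvee_i V_i)=\bigvee_i\mathrm{sub}(B,V_i)$ for all families $(V_i)$ of open sets. For an $L$-ordered set $P$, let $\Sigma_LP=(P,\sigma_L(P))$, where $\sigma_L(P)$ consists of the $A\in L^P$ with $A(x)\wedge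 e(x,y)\le A(y)$ for all $x,y$ and $A(\sqcup D)=\bigvee_x A(x)\wedge D(x)$ for all $D\in\mathcal D^*(P)$. For a $T_0$ space $X$, let $\Omega_LX$ be $X$ with the $L$-order $e(x,y)=\bigwedge_{A\in\mathcal O(X)}A(x)\to A(y)$. On maps, put $\Sigma_Lf=f$ and $\Omega_Lf=f$. Let $P$ be a continuous $L$-ordered set. A directed completion of $P$ is a continuous $L$-dcpo $Q$ for which there is a Scott continuous map $j:P\to Q$ such that every Scott continuous map $f$ from $P$ to a continuous $L$-dcpo $M$ is $f=\bar f\circ j$ for a unique Scott continuous $\bar f:Q\to M$. An $L$-sobrification of $\Sigma_LP$ is an $L$-sober space $Y$ for which there is a continuous map $j:\Sigma_LP\to Y$ such that every continuous map $f$ from $\Sigma_LP$ to an $L$-sober space $Z$ is $f=\bar f\circ j$ for a unique continuous $\bar f:Y\to Z$. Let $\mathbf D_L(P)$ be the category of directed completions of $P$ with all Scott continuous maps between them, and $\mathbf S_L(P)$ the category of $L$-sobrifications of $\Sigma_LP$ with all continuous maps between them. Then every object of $\mathbf S_L(P)$ is locally super-compact, and $\Sigma_L$ and $\Omega_L$ restrict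 to functors $\Sigma_L:\mathbf D_L(P)\to\mathbf S_L(P)$ and $\Omega_L:\mathbf S_L(P)\to\mathbf D_L(P)$ which are mutually inverse, i.e. $\Omega_L\circ\Sigma_L=\mathrm{id}_{\mathbf D_L(P)}$ and $\Sigma_L\circ\Omega_L=\mathrm{id}_{\mathbf S_L(P)}$. Hence $\mathbf D_L(P)$ and $\mathbf S_L(P)$ are isomorphic categories. -/

import Mathlib

open CategoryTheory

universe u v w

/-! ### `L`-subsets

Throughout, `L` is a frame and an `L`-subset of `X` is a map `X → L`. -/

section LSubsets

variable {L : Type u} [Order.Frame L] {X : Type v} {Y : Type w}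

/-- The inclusion degree `sub(A, B) = ⋀ₓ A(x) → B(x)` of two `L`-subsets. -/
def lsub (A B : X → L) : L := ⨅ x, A x ⇨ B x

/-- The forward Zadeh extension `f^→ : L^X → L^Y`. -/
def zadehImage (f : X → Y) (A : X → L) : Y → L := fun y => ⨆ (x : X) (_ : f x = y), A x

end LSubsets

/-! ### `L`-ordered sets -/

/-- An `L`-order on `P`. -/
@[ext]
structure LOrder (L : Type u) [Order.Frame L] (P : Type v) where
  /-- the degree to which `x` is below `y` -/
  rel : P → P → L
  rel_refl : ∀ x, rel x x = ⊤
  rel_trans : ∀ x y z, rel x y ⊓ rel y z ≤ rel x z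
  rel_antisymm : ∀ x y, rel x y ⊓ rel y x = ⊤ → x = y

namespace LOrder

variable {L : Type u} [Order.Frame L] {P : Type v} (e : LOrder L P)

/-- `↓y`, the `L`-subset `x ↦ e(x, y)`. -/
def lower (y : P) : P → L := fun x => e.rel x y

/-- `x` is a supremum of the `L`-subset `A`: `e(x, y) = sub(A, ↓y)` for all `y`. -/
def IsSup (A : P → L) (x : P) : Prop := ∀ y, e.rel x y = lsub A (e.lower y)

/-- Directed `L`-subsets (nonemptiness is included). -/
def IsDirected (D : P → L) : Prop :=
  (⨆ x, D x) = ⊤ ∧ ∀ x y, D x ⊓ D y ≤ ⨆ z, D z ⊓ e.rel x z ⊓ e.rel y z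

/-- An `L`-dcpo: every directed `L`-subset has a supremum. -/
def IsDcpo : Prop := ∀ D : P → L, e.IsDirected D → ∃ x, e.IsSup D x

/-- `e.wayBelow x y` is the value `(⇓x)(y)`; the infimum runs over all directed `L`-subsets `D`
that have a supremum `s`. -/
def wayBelow (x : P) : P → L := fun y =>
  ⨅ (D : P → L) (s : P) (_ : e.IsDirected D) (_ : e.IsSup D s),
    e.rel x s ⇨ ⨆ d, D d ⊓ e.rel y d

/-- Continuous `L`-ordered sets (not necessarily `L`-dcpos). -/
def IsContinuous : Prop := ∀ x, e.IsDirected (e.wayBelow x) ∧ e.IsSup (e.wayBelow x) x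

/-- Scott continuous maps: suprema of directed `L`-subsets, where they exist, are preserved. -/
def ScottContinuous {Q : Type w} (e : LOrder L P) (e' : LOrder L Q) (f : P → Q) : Prop :=
  ∀ (D : P → L) (s : P), e.IsDirected D → e.IsSup D s → e'.IsSup (zadehImage f D) (f s)

/-- `L`-order-preserving maps. -/
def OrderPreserving {Q : Type w} (e : LOrder L P) (e' : LOrder L Q) (f : P → Q) : Prop :=
  ∀ x y, e.rel x y ≤ e'.rel (f x) (f y)

/-- Scott open `L`-subsets: upper sets `A` with `A(⊔D) = ⋁ₓ A(x) ∧ D(x)` for every directed `D`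
that has a supremum. -/
def IsScottOpen (A : P → L) : Prop :=
  (∀ x y, A x ⊓ e.rel x y ≤ A y) ∧
    ∀ (D : P → L) (s : P), e.IsDirected D → e.IsSup D s → A s = ⨆ x, A x ⊓ D x

end LOrder

/-! ### `L`-topological spaces -/

/-- A (stratified) `L`-topology on `X`. -/
@[ext]
structure LTopology (L : Type u) [Order.Frame L] (X : Type v) where
  /-- the family of open `L`-subsets -/
  opens : Set (X → L)
  inf_mem : ∀ {A B}, A ∈ opens → B ∈ opens → A ⊓ B ∈ opens
  sSup_mem : ∀ {S : Set (X → L)}, S ⊆ opens → sSup S ∈ opens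
  const_mem : ∀ a : L, (fun _ => a) ∈ opens

namespace LTopology

variable {L : Type u} [Order.Frame L] {X : Type v} (τ : LTopology L X)

/-- Continuous maps: preimages of open `L`-subsets are open. -/
def ContinuousMap {Y : Type w} (τ : LTopology L X) (τ' : LTopology L Y) (f : X → Y) : Prop :=
  ∀ B ∈ τ'.opens, B ∘ f ∈ τ.opens

/-- The `T₀` axiom. -/
def IsT0 : Prop := ∀ x y, (∀ A ∈ τ.opens, A x = A y) → x = y

/-- The interior of an `L`-subset. -/
def interior (A : X → L) : X → L := sSup {B | B ∈ τ.opens ∧ B ≤ A}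

/-- Points of the `L`-frame of open sets. -/
structure Point where
  /-- the underlying map `𝒪(X) → L` -/
  toFun : τ.opens → L
  map_inf : ∀ A B : τ.opens, toFun ⟨A.1 ⊓ B.1, τ.inf_mem A.2 B.2⟩ = toFun A ⊓ toFun B
  map_sSup : ∀ (S : Set (X → L)) (hS : S ⊆ τ.opens),
    toFun ⟨sSup S, τ.sSup_mem hS⟩ = ⨆ A : S, toFun ⟨A.1, hS A.2⟩
  map_const : ∀ a : L, toFun ⟨fun _ => a, τ.const_mem a⟩ = a

/-- The point `[x]`, evaluation of open `L`-subsets at `x`. -/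
def evalPoint (x : X) : τ.Point where
  toFun A := A.1 x
  map_inf _ _ := rfl
  map_sSup _ _ := sSup_apply
  map_const _ := rfl

/-- `L`-sobriety: `x ↦ [x]` is a bijection onto the points of `𝒪(X)`. -/
def IsSober : Prop := Function.Bijective τ.evalPoint

/-- Super-compact `L`-subsets. -/
def IsSuperCompact (A : X → L) : Prop :=
  (⨆ x, A x) = ⊤ ∧ ∀ S : Set (X → L), S ⊆ τ.opens → lsub A (sSup S) = ⨆ V : S, lsub A V.1

/-- Locally super-compact `L`-topological spaces. -/
def IsLocallySuperCompact : Prop :=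
  ∀ A ∈ τ.opens, ∀ x, A x = ⨆ (B : X → L) (_ : τ.IsSuperCompact B), lsub B A ⊓ τ.interior B x

theorem IsSober.isT0 {τ : LTopology L X} (h : τ.IsSober) : τ.IsT0 := by
  intro x y hxy
  apply h.1
  have : (fun A : τ.opens => A.1 x) = fun A : τ.opens => A.1 y := funext fun A => hxy A.1 A.2
  simp only [evalPoint, this]

/-- The specialization `L`-order of a `T₀` space: `e(x, y) = ⋀ A(x) → A(y)` over open `A`. -/
def specializationOrder (h : τ.IsT0) : LOrder L X where
  rel x y := ⨅ A : τ.opens, A.1 x ⇨ A.1 y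
  rel_refl x := by simp
  rel_trans x y z := le_iInf fun A =>
    (inf_le_inf (iInf_le _ A) (iInf_le _ A)).trans (himp_triangle _ _ _)
  rel_antisymm x y hxy := by
    rw [inf_eq_top_iff] at hxy
    refine h x y fun A hA => le_antisymm ?_ ?_
    · exact himp_eq_top_iff.1 (top_le_iff.1 (hxy.1 ▸ iInf_le (fun A : τ.opens => A.1 x ⇨ A.1 y) ⟨A, hA⟩))
    · exact himp_eq_top_iff.1 (top_le_iff.1 (hxy.2 ▸ iInf_le (fun A : τ.opens => A.1 y ⇨ A.1 x) ⟨A, hA⟩))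

end LTopology

/-! ### The Scott `L`-topology -/

namespace LOrder

variable {L : Type u} [Order.Frame L] {P : Type v}

/-- The Scott `L`-topology `σ_L(P)`. -/
def scottTopology (e : LOrder L P) : LTopology L P where
  opens := {A | e.IsScottOpen A}
  inf_mem := by
    rintro A B ⟨hA, hA'⟩ ⟨hB, hB'⟩
    refine ⟨fun x y => le_inf ((inf_le_inf_right _ inf_le_left).trans (hA x y))
      ((inf_le_inf_right _ inf_le_right).trans (hB x y)), fun D s hD hs => le_antisymm ?_ ?_⟩
    · rw [Pi.inf_apply, hA' D s hD hs, hB' D s hD hs, iSup_inf_iSup]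
      refine iSup_le fun ⟨x, y⟩ => ?_
      calc A x ⊓ D x ⊓ (B y ⊓ D y) = (A x ⊓ B y) ⊓ (D x ⊓ D y) := inf_inf_inf_comm _ _ _ _
        _ ≤ (A x ⊓ B y) ⊓ ⨆ z, D z ⊓ e.rel x z ⊓ e.rel y z := inf_le_inf_left _ (hD.2 x y)
        _ = ⨆ z, (A x ⊓ B y) ⊓ (D z ⊓ e.rel x z ⊓ e.rel y z) := inf_iSup_eq _ _
        _ ≤ ⨆ z, (A ⊓ B) z ⊓ D z := iSup_mono fun z => by
          refine le_inf (le_inf (le_trans (le_inf ?_ ?_) (hA x z))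
            (le_trans (le_inf ?_ ?_) (hB y z))) ?_
          · exact inf_le_left.trans inf_le_left
          · exact inf_le_right.trans (inf_le_left.trans inf_le_right)
          · exact inf_le_left.trans inf_le_right
          · exact inf_le_right.trans inf_le_right
          · exact inf_le_right.trans (inf_le_left.trans inf_le_left)
    · refine iSup_le fun x => le_inf ?_ ?_
      · rw [hA' D s hD hs]
        exact (inf_le_inf_right _ inf_le_left).trans (le_iSup (fun x => A x ⊓ D x) x)
      · rw [hB' D s hD hs]
        exact (inf_le_inf_right _ inf_le_right).trans (le_iSup (fun x => B x ⊓ D x) x)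
  sSup_mem := by
    intro S hS
    refine ⟨fun x y => ?_, fun D s hD hs => ?_⟩
    · rw [sSup_apply, sSup_apply, iSup_inf_eq]
      exact iSup_mono fun A => (hS A.2).1 x y
    · simp only [sSup_apply, iSup_inf_eq]
      rw [iSup_comm]
      exact iSup_congr fun A => (hS A.2).2 D s hD hs
  const_mem a := ⟨fun _ _ => inf_le_left, fun D s hD _ => by
    rw [← inf_iSup_eq, hD.1, inf_top_eq]⟩

variable {Q : Type v} {R : Type v} {e : LOrder L P} {e' : LOrder L Q} {e'' : LOrder L R}

theorem ScottContinuous.orderPreserving {f : P → Q} (hf : e.ScottContinuous e' f) :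
    e.OrderPreserving e' f := by
  intro x y
  have hd : e.IsDirected (e.lower y) := by
    refine ⟨top_le_iff.1 ?_, fun a b => ?_⟩
    · rw [← e.rel_refl y]
      exact le_iSup (e.lower y) y
    · refine le_trans ?_ (le_iSup _ y)
      simp [lower, e.rel_refl]
  have hs : e.IsSup (e.lower y) y := by
    intro z
    refine le_antisymm (le_iInf fun a => le_himp_iff.2 ?_) ?_
    · rw [inf_comm]
      exact e.rel_trans a y z
    · refine (iInf_le _ y).trans ?_
      simp [lower, e.rel_refl]
  have h1 : lsub (zadehImage f (e.lower y)) (e'.lower (f y)) = ⊤ := by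
    rw [← hf _ _ hd hs, e'.rel_refl]
  have h2 := iInf_le (fun q => zadehImage f (e.lower y) q ⇨ e'.lower (f y) q) (f x)
  change lsub _ _ ≤ _ at h2
  rw [h1, top_le_iff, himp_eq_top_iff] at h2
  exact le_trans (le_iSup₂_of_le (f := fun a (_ : f a = f x) => e.lower y a) x rfl le_rfl) h2

theorem OrderPreserving.isDirected {f : P → Q} (hf : e.OrderPreserving e' f) {D : P → L}
    (hD : e.IsDirected D) : e'.IsDirected (zadehImage f D) := by
  have key : ∀ x, D x ≤ zadehImage f D (f x) := fun x =>
    le_iSup₂_of_le (f := fun a (_ : f a = f x) => D a) x rfl le_rfl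
  refine ⟨top_le_iff.1 ?_, fun a b => ?_⟩
  · rw [← hD.1]
    exact iSup_le fun x => (key x).trans (le_iSup (zadehImage f D) (f x))
  · simp only [zadehImage, iSup_inf_eq, inf_iSup_eq]
    refine iSup_le fun y => iSup_le fun hy => iSup_le fun x => iSup_le fun hx => ?_
    subst hx hy
    refine (hD.2 _ _).trans (iSup_le fun z => ?_)
    refine le_iSup_of_le (f z) (le_iSup₂_of_le z rfl ?_)
    exact inf_le_inf (inf_le_inf le_rfl (hf _ _)) (hf _ _)

theorem ScottContinuous.id (e : LOrder L P) : e.ScottContinuous e _root_.id := by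
  intro D s _ hs
  have : zadehImage _root_.id D = D := by
    funext y
    simp [zadehImage]
  rw [this]
  exact hs

theorem ScottContinuous.comp {g : Q → R} {f : P → Q} (hg : e'.ScottContinuous e'' g)
    (hf : e.ScottContinuous e' f) : e.ScottContinuous e'' (g ∘ f) := by
  intro D s hD hs
  have : zadehImage (g ∘ f) D = zadehImage g (zadehImage f D) := by
    funext y
    refine le_antisymm (iSup₂_le fun x hx => ?_) (iSup₂_le fun z hz => iSup₂_le fun x hx => ?_)
    · exact le_iSup₂_of_le (f x) hx (le_iSup₂_of_le x rfl le_rfl)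
    · subst hx
      exact le_iSup₂_of_le x hz le_rfl
  rw [this]
  exact hg _ _ (hf.orderPreserving.isDirected hD) (hf D s hD hs)

theorem ScottContinuous.continuousMap {f : P → Q} (hf : e.ScottContinuous e' f) :
    e.scottTopology.ContinuousMap e'.scottTopology f := by
  rintro B ⟨hB, hB'⟩
  refine ⟨fun x y => (inf_le_inf_left _ (hf.orderPreserving x y)).trans (hB _ _), ?_⟩
  intro D s hD hs
  change B (f s) = _
  rw [hB' _ _ (hf.orderPreserving.isDirected hD) (hf D s hD hs)]
  refine le_antisymm (iSup_le fun y => ?_) (iSup_le fun x => ?_)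
  · simp only [zadehImage, inf_iSup_eq]
    refine iSup₂_le fun x hx => ?_
    subst hx
    exact le_iSup (fun x => (B ∘ f) x ⊓ D x) x
  · exact le_iSup_of_le (f x) (inf_le_inf_left _
      (le_iSup₂_of_le (f := fun a (_ : f a = f x) => D a) x rfl le_rfl))

end LOrder

theorem LTopology.ContinuousMap.orderPreserving {L : Type u} [Order.Frame L] {X : Type v}
    {Y : Type w} {τ : LTopology L X} {τ' : LTopology L Y} {f : X → Y}
    (hf : τ.ContinuousMap τ' f) (h : τ.IsT0) (h' : τ'.IsT0) :
    (τ.specializationOrder h).OrderPreserving (τ'.specializationOrder h') f := fun x y =>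
  le_iInf fun B => iInf_le (fun A : τ.opens => A.1 x ⇨ A.1 y) ⟨B.1 ∘ f, hf B.1 B.2⟩

/-! ### The categories and the functors `Σ_L` and `Ω_L` -/

/-- `L`-ordered sets, as objects of the category with Scott continuous maps. -/
structure LPosScott (L : Type u) [Order.Frame L] where
  /-- the underlying set -/
  carrier : Type w
  /-- the `L`-order -/
  order : LOrder L carrier

/-- `L`-ordered sets, as objects of the category with `L`-order-preserving maps. -/
structure LPosMono (L : Type u) [Order.Frame L] where
  /-- the underlying set -/
  carrier : Type w
  /-- the `L`-order -/
  order : LOrder L carrier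

/-- `L`-topological spaces. -/
structure LTopCat (L : Type u) [Order.Frame L] where
  /-- the underlying set -/
  carrier : Type w
  /-- the `L`-topology -/
  topology : LTopology L carrier

section Categories

variable (L : Type u) [Order.Frame L]

/-- Scott continuous maps. -/
@[ext]
structure LPosScott.Hom (P Q : LPosScott.{u, w} L) where
  /-- the underlying map -/
  toFun : P.carrier → Q.carrier
  prop : P.order.ScottContinuous Q.order toFun

instance : Category.{w} (LPosScott.{u, w} L) where
  Hom := LPosScott.Hom L
  id P := ⟨_root_.id, LOrder.ScottContinuous.id P.order⟩
  comp f g := ⟨g.toFun ∘ f.toFun, g.prop.comp f.prop⟩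

/-- `L`-order-preserving maps. -/
@[ext]
structure LPosMono.Hom (P Q : LPosMono.{u, w} L) where
  /-- the underlying map -/
  toFun : P.carrier → Q.carrier
  prop : P.order.OrderPreserving Q.order toFun

instance : Category.{w} (LPosMono.{u, w} L) where
  Hom := LPosMono.Hom L
  id P := ⟨_root_.id, fun _ _ => le_rfl⟩
  comp f g := ⟨g.toFun ∘ f.toFun, fun x y => (f.prop x y).trans (g.prop _ _)⟩

/-- Continuous maps. -/
@[ext]
structure LTopCat.Hom (X Y : LTopCat.{u, w} L) where
  /-- the underlying map -/
  toFun : X.carrier → Y.carrier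
  prop : X.topology.ContinuousMap Y.topology toFun

instance : Category.{w} (LTopCat.{u, w} L) where
  Hom := LTopCat.Hom L
  id X := ⟨_root_.id, fun _ hB => hB⟩
  comp f g := ⟨g.toFun ∘ f.toFun, fun B hB => f.prop _ (g.prop B hB)⟩

/-- Every Scott continuous map is `L`-order-preserving. -/
def LPosScott.toMono : LPosScott.{u, w} L ⥤ LPosMono.{u, w} L where
  obj P := ⟨P.carrier, P.order⟩
  map f := ⟨f.toFun, f.prop.orderPreserving⟩

/-- The category of continuous `L`-dcpos and Scott continuous maps. -/
abbrev CDom :=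
  ObjectProperty.FullSubcategory
    (fun P : LPosScott.{u, w} L => P.order.IsContinuous ∧ P.order.IsDcpo)

/-- The category of `T₀` `L`-topological spaces and continuous maps. -/
abbrev LTopT0 :=
  ObjectProperty.FullSubcategory (fun X : LTopCat.{u, w} L => X.topology.IsT0)

/-- The category of `L`-sober spaces and continuous maps. -/
abbrev LSob :=
  ObjectProperty.FullSubcategory (fun X : LTopCat.{u, w} L => X.topology.IsSober)

/-- The inclusion of continuous `L`-dcpos into `L`-ordered sets. -/
abbrev CDom.incl : CDom.{u, w} L ⥤ LPosScott.{u, w} L := ObjectProperty.ι _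

/-- The inclusion of `L`-sober spaces into `L`-topological spaces. -/
abbrev LSob.incl : LSob.{u, w} L ⥤ LTopCat.{u, w} L := ObjectProperty.ι _

/-- The inclusion of `L`-sober spaces into `T₀` `L`-topological spaces. -/
abbrev LSob.toT0 : LSob.{u, w} L ⥤ LTopT0.{u, w} L :=
  ObjectProperty.ιOfLE fun _ h => h.isT0

/-- The functor `Σ_L`: it sends `P` to its Scott space and `f` to `f`. -/
def sigmaL : LPosScott.{u, w} L ⥤ LTopCat.{u, w} L where
  obj P := ⟨P.carrier, P.order.scottTopology⟩
  map f := ⟨f.toFun, f.prop.continuousMap⟩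

/-- The functor `Ω_L`: it sends a `T₀` space to its set of points with the specialization
`L`-order and `f` to `f`. -/
def omegaL : LTopT0.{u, w} L ⥤ LPosMono.{u, w} L where
  obj X := ⟨X.obj.carrier, X.obj.topology.specializationOrder X.property⟩
  map {X Y} f := ⟨f.hom.toFun, f.hom.prop.orderPreserving X.property Y.property⟩

end Categories

/-! ### Directed completions and `L`-sobrifications -/

section Completions

variable {L : Type u} [Order.Frame L] {P : Type v}

/-- `Q` is a directed completion of `(P, e)`: some Scott continuous `j : P → Q` is universal among
Scott continuous maps from `P` to continuous `L`-dcpos. -/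
def IsDirectedCompletion (e : LOrder L P) (Q : CDom.{u, w} L) : Prop :=
  ∃ j : P → Q.obj.carrier, e.ScottContinuous Q.obj.order j ∧
    ∀ (M : CDom.{u, w} L) (f : P → M.obj.carrier), e.ScottContinuous M.obj.order f →
      ∃! g : Q.obj.carrier → M.obj.carrier,
        Q.obj.order.ScottContinuous M.obj.order g ∧ g ∘ j = f

/-- `Y` is an `L`-sobrification of `(P, τ)`: some continuous `j : P → Y` is universal among
continuous maps from `P` to `L`-sober spaces. -/
def IsLSobrification (τ : LTopology L P) (Y : LSob.{u, w} L) : Prop :=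
  ∃ j : P → Y.obj.carrier, τ.ContinuousMap Y.obj.topology j ∧
    ∀ (Z : LSob.{u, w} L) (f : P → Z.obj.carrier), τ.ContinuousMap Z.obj.topology f →
      ∃! g : Y.obj.carrier → Z.obj.carrier,
        Y.obj.topology.ContinuousMap Z.obj.topology g ∧ g ∘ j = f

/-- The category of directed completions of `(P, e)`, with all Scott continuous maps as
morphisms. Its objects live in a universe large enough to contain the points of `σ_L(P)`. -/
abbrev DirectedCompletions (e : LOrder L P) :=
  ObjectProperty.FullSubcategory (fun Q : CDom.{u, max u v} L => IsDirectedCompletion e Q)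

/-- The category of `L`-sobrifications of `(P, τ)`, with all continuous maps as morphisms. -/
abbrev LSobrifications (τ : LTopology L P) :=
  ObjectProperty.FullSubcategory (fun Y : LSob.{u, max u v} L => IsLSobrification τ Y)

/-- The inclusion of directed completions into continuous `L`-dcpos. -/
abbrev DirectedCompletions.incl (e : LOrder L P) :
    DirectedCompletions e ⥤ CDom.{u, max u v} L := ObjectProperty.ι _

/-- The inclusion of `L`-sobrifications into `L`-sober spaces. -/
abbrev LSobrifications.incl (τ : LTopology L P) :
    LSobrifications τ ⥤ LSob.{u, max u v} L := ObjectProperty.ι _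

end Completions

/-! Directed completions and sobrifications turn out to be described by the same data: a map out of
`P` that induces a bijection of open `L`-subsets (`IsQuasiHomeomorphism`). Such a map is universal
among continuous maps to sober spaces (`existsUnique_lift`), and the canonical map to the space of
points is one of them. Comparing an arbitrary universal map with it gives `isLSobrification_iff`.

For Scott spaces the order side joins in. In a continuous `L`-ordered set the opens `x ↦ ⇓x(z)` form
a basis, so the Scott opens recover the order (`rel_eq_iInf`), Scott continuity into a continuous
codomain is topological continuity, and the Scott space of a continuous `L`-dcpo is sober.
Conversely, the basis of `P` extends along a quasi-homeomorphism to a sober space `Y`; it shows that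
the specialization order of `Y` is a continuous `L`-dcpo whose Scott opens are exactly the opens of
`Y` (`IsQuasiHomeomorphism.specializationOrder`). In particular the space of points is available as
a comparison object for directed completions too, which gives `isDirectedCompletion_iff`. Passing
between order and topology loses nothing in either direction, so the functors are inverse on
objects, and they do not change underlying maps. -/

/-! ### Reasoning with degrees in a frame -/

section Frames

variable {L : Type u} [Order.Frame L]

/-- Frame distributivity as an elimination rule for existentials: an index may be picked at the cost
of shrinking the current degree `c` to `d`. -/
theorem le_of_le_iSup {ι : Sort w} {f : ι → L} {c b : L} (h : c ≤ ⨆ i, f i)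
    (H : ∀ i d, d ≤ c → d ≤ f i → d ≤ b) : c ≤ b := by
  rw [← inf_eq_left.2 h, inf_iSup_eq]
  exact iSup_le fun i => H i _ inf_le_left inf_le_right

/-- Heyting implication is read as forcing: it must hold at every smaller degree. -/
theorem le_lsub_iff {X : Type v} {A B : X → L} {c : L} :
    c ≤ lsub A B ↔ ∀ x d, d ≤ c → d ≤ A x → d ≤ B x := by
  simp only [lsub, le_iInf_iff, le_himp_iff]
  exact forall_congr' fun x => ⟨fun h d h1 h2 => (le_inf h1 h2).trans h,
    fun h => h _ inf_le_left inf_le_right⟩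

theorem le_zadehImage {X : Type v} {Y : Type w} (f : X → Y) (A : X → L) (x : X) :
    A x ≤ zadehImage f A (f x) :=
  le_iSup₂_of_le (f := fun a (_ : f a = f x) => A a) x rfl le_rfl

theorem iSup_zadehImage_inf {X : Type v} {Y : Type w} (f : X → Y) (A : X → L) (B : Y → L) :
    ⨆ y, zadehImage f A y ⊓ B y = ⨆ x, A x ⊓ B (f x) := by
  refine le_antisymm (iSup_le fun y => ?_) (iSup_le fun x => ?_)
  · simp only [zadehImage, iSup_inf_eq]
    refine iSup₂_le fun x hx => ?_
    subst hx
    exact le_iSup (fun x => A x ⊓ B (f x)) x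
  · exact le_iSup_of_le (f x) (inf_le_inf_right _ (le_zadehImage f A x))

theorem lsub_zadehImage {X : Type v} {Y : Type w} (f : X → Y) (A : X → L) (B : Y → L) :
    lsub (zadehImage f A) B = lsub A (B ∘ f) := by
  refine le_antisymm (le_iInf fun x => (iInf_le _ (f x)).trans
    (himp_le_himp_right (le_zadehImage f A x))) (le_iInf fun y => ?_)
  simp only [zadehImage, iSup_himp_eq]
  refine le_iInf₂ fun x hx => ?_
  subst hx
  exact iInf_le _ x

end Frames

/-! ### Suprema, the way-below relation and Scott opens -/

namespace LOrder

variable {L : Type u} [Order.Frame L] {P : Type v} {e : LOrder L P}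

theorem rel_trans_le {x y z : P} {c : L} (h : c ≤ e.rel x y) (h' : c ≤ e.rel y z) :
    c ≤ e.rel x z := (le_inf h h').trans (e.rel_trans x y z)

/-- Least upper bound at every degree. Only one inequality is asked for in the second clause; the
other follows from the first by transitivity. -/
theorem isSup_iff {A : P → L} {s : P} : e.IsSup A s ↔
    (∀ x, A x ≤ e.rel x s) ∧
      ∀ t c, (∀ x d, d ≤ c → d ≤ A x → d ≤ e.rel x t) → c ≤ e.rel s t := by
  constructor
  · intro h
    refine ⟨fun x => ?_, fun t c hc => ?_⟩
    · have := (e.rel_refl s).ge.trans (h s).le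
      exact le_lsub_iff.1 this x _ le_top le_rfl
    · rw [h t]
      exact le_lsub_iff.2 hc
  · rintro ⟨h, h'⟩ t
    refine le_antisymm (le_lsub_iff.2 fun x d h1 h2 => rel_trans_le (h2.trans (h x)) h1)
      (h' _ _ fun x d h1 h2 => le_lsub_iff.1 h1 x d le_rfl h2)

theorem IsSup.unique {A : P → L} {s t : P} (hs : e.IsSup A s) (ht : e.IsSup A t) : s = t := by
  refine e.rel_antisymm s t ?_
  rw [hs t, ← ht t, ht s, ← hs s, e.rel_refl, e.rel_refl, inf_top_eq]

theorem IsDirected.le_iSup {D : P → L} (hD : e.IsDirected D) {x y : P} {c : L}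
    (hx : c ≤ D x) (hy : c ≤ D y) : c ≤ ⨆ z, D z ⊓ e.rel x z ⊓ e.rel y z :=
  (le_inf hx hy).trans (hD.2 x y)

theorem wayBelow_le_iSup {D : P → L} {s x y : P} {c : L} (hD : e.IsDirected D) (hs : e.IsSup D s)
    (h : c ≤ e.wayBelow x y) (hx : c ≤ e.rel x s) : c ≤ ⨆ d, D d ⊓ e.rel y d := by
  have h1 : e.wayBelow x y ≤ e.rel x s ⇨ ⨆ d, D d ⊓ e.rel y d :=
    iInf_le_of_le D (iInf_le_of_le s (iInf₂_le_of_le hD hs le_rfl))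
  exact (le_inf h hx).trans (le_himp_iff.1 h1)

theorem le_wayBelow {x y : P} {c : L}
    (h : ∀ (D : P → L) (s : P), e.IsDirected D → e.IsSup D s → ∀ d ≤ c, d ≤ e.rel x s →
      d ≤ ⨆ d, D d ⊓ e.rel y d) : c ≤ e.wayBelow x y :=
  le_iInf fun D => le_iInf fun s => le_iInf₂ fun hD hs => le_himp_iff.2
    (h D s hD hs _ inf_le_left inf_le_right)

theorem le_wayBelow_of_le {x x' y y' : P} {c : L} (h : c ≤ e.wayBelow x y) (hx : c ≤ e.rel x x')
    (hy : c ≤ e.rel y' y) : c ≤ e.wayBelow x' y' := by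
  refine le_wayBelow fun D s hD hs d hd hds => ?_
  refine le_of_le_iSup (wayBelow_le_iSup hD hs (hd.trans h) (rel_trans_le (hd.trans hx) hds))
    fun z b hb hz => le_iSup_of_le z (le_inf (hz.trans inf_le_left) ?_)
  exact rel_trans_le ((hb.trans hd).trans hy) (hz.trans inf_le_right)

/-- If `⇓x` contains a directed `L`-subset with supremum `x`, it is itself one. -/
theorem isDirected_wayBelow_of_le {D : P → L} {x : P} (hD : e.IsDirected D) (hs : e.IsSup D x)
    (h : ∀ y, D y ≤ e.wayBelow x y) : e.IsDirected (e.wayBelow x) ∧ e.IsSup (e.wayBelow x) x := by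
  -- Testing `⇓x` against `D` itself bounds it by the lower closure of `D`, so `D` is cofinal in
  -- `⇓x`.
  have key : ∀ {y c}, c ≤ e.wayBelow x y → c ≤ ⨆ d, D d ⊓ e.rel y d := fun hc =>
    wayBelow_le_iSup hD hs hc (by simp [e.rel_refl])
  refine ⟨⟨top_le_iff.1 (hD.1.ge.trans (iSup_mono h)), fun a b => ?_⟩, isSup_iff.2 ⟨fun y => ?_, ?_⟩⟩
  · refine le_of_le_iSup (key inf_le_left) fun a' c hc ha => ?_
    refine le_of_le_iSup (key (hc.trans inf_le_right)) fun b' d hd hb => ?_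
    refine le_of_le_iSup (hD.le_iSup ((hd.trans ha).trans inf_le_left) (hb.trans inf_le_left))
      fun z g hg hz => le_iSup_of_le z (le_inf (le_inf ?_ ?_) ?_)
    · exact hz.trans (inf_le_left.trans (inf_le_left.trans (h z)))
    · exact rel_trans_le ((hg.trans hd).trans (ha.trans inf_le_right))
        (hz.trans (inf_le_left.trans inf_le_right))
    · exact rel_trans_le (hg.trans (hb.trans inf_le_right)) (hz.trans inf_le_right)
  · exact le_of_le_iSup (key le_rfl) fun z c hc hz => rel_trans_le (hz.trans inf_le_right)
      (hz.trans (inf_le_left.trans ((isSup_iff.1 hs).1 z)))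
  · exact fun t c hc => (isSup_iff.1 hs).2 t c fun y d hd hy => hc y d hd (hy.trans (h y))

namespace IsContinuous

variable (he : e.IsContinuous)
include he

theorem wayBelow_le_rel (x y : P) : e.wayBelow x y ≤ e.rel y x := (isSup_iff.1 (he x).2).1 y

/-- The interpolation property. -/
theorem wayBelow_eq_iSup (x y : P) :
    e.wayBelow x y = ⨆ z, e.wayBelow x z ⊓ e.wayBelow z y := by
  refine le_antisymm ?_ (iSup_le fun z => le_wayBelow_of_le inf_le_left (by simp [e.rel_refl])
    (inf_le_right.trans (he.wayBelow_le_rel z y)))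
  -- The right-hand side is itself directed with supremum `x`, so `⇓x` can be tested against it.
  have hD : e.IsDirected fun y => ⨆ z, e.wayBelow x z ⊓ e.wayBelow z y := by
    constructor
    · rw [iSup_comm]
      simp only [← inf_iSup_eq, (he _).1.1, inf_top_eq]
    · intro a b
      refine le_of_le_iSup inf_le_left fun a' c hc ha => ?_
      refine le_of_le_iSup (hc.trans inf_le_right) fun b' d hd hb => ?_
      refine le_of_le_iSup ((he x).1.le_iSup ((hd.trans ha).trans inf_le_left)
        (hb.trans inf_le_left)) fun w g hg hw => ?_
      have h1 : g ≤ e.wayBelow w a := le_wayBelow_of_le ((hg.trans hd).trans (ha.trans inf_le_right))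
        (hw.trans (inf_le_left.trans inf_le_right)) (by simp [e.rel_refl])
      have h2 : g ≤ e.wayBelow w b := le_wayBelow_of_le (hg.trans (hb.trans inf_le_right))
        (hw.trans inf_le_right) (by simp [e.rel_refl])
      refine le_of_le_iSup ((he w).1.le_iSup h1 h2) fun z k hk hz =>
        le_iSup_of_le z (le_inf (le_inf ?_ ?_) ?_)
      · exact le_iSup_of_le w (le_inf (hk.trans (hw.trans (inf_le_left.trans inf_le_left)))
          (hz.trans (inf_le_left.trans inf_le_left)))
      · exact hz.trans (inf_le_left.trans inf_le_right)
      · exact hz.trans inf_le_right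
  have hs : e.IsSup (fun y => ⨆ z, e.wayBelow x z ⊓ e.wayBelow z y) x := by
    refine isSup_iff.2 ⟨fun y => iSup_le fun z => rel_trans_le
      (inf_le_right.trans (he.wayBelow_le_rel z y)) (inf_le_left.trans (he.wayBelow_le_rel x z)),
      fun t c hc => (isSup_iff.1 (he x).2).2 t c fun z d hd hz =>
        (isSup_iff.1 (he z).2).2 t d fun y g hg hy => ?_⟩
    exact hc y g (hg.trans hd) (le_iSup_of_le z (le_inf (hg.trans hz) hy))
  refine le_of_le_iSup (wayBelow_le_iSup hD hs le_rfl (by simp [e.rel_refl])) fun d c hc hd => ?_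
  refine le_of_le_iSup (hd.trans inf_le_left) fun z g hg hz =>
    le_iSup_of_le z (le_inf (hz.trans inf_le_left) ?_)
  exact le_wayBelow_of_le (hz.trans inf_le_right) (by simp [e.rel_refl])
    (hg.trans (hd.trans inf_le_right))

/-- Interpolate `y ≪ z ≪ ⊔D`: then `z` lies below a member `d` of `D`, whence `y ≪ d`. -/
theorem isScottOpen_wayBelow (y : P) : e.IsScottOpen fun x => e.wayBelow x y := by
  refine ⟨fun a b => le_wayBelow_of_le inf_le_left inf_le_right (by simp [e.rel_refl]),
    fun D s hD hs => le_antisymm ?_ (iSup_le fun x => ?_)⟩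
  · refine le_of_le_iSup (he.wayBelow_eq_iSup s y).le fun z c hc hz => ?_
    refine le_of_le_iSup (wayBelow_le_iSup hD hs (hz.trans inf_le_left) (by simp [e.rel_refl]))
      fun d g hg hd => le_iSup_of_le d (le_inf ?_ (hd.trans inf_le_left))
    exact le_wayBelow_of_le (hg.trans (hz.trans inf_le_right)) (hd.trans inf_le_right)
      (by simp [e.rel_refl])
  · exact le_wayBelow_of_le inf_le_left (inf_le_right.trans ((isSup_iff.1 hs).1 x))
      (by simp [e.rel_refl])

/-- Evaluating `A` at `x = ⊔⇓x` expands it in the basis of way-below opens. -/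
theorem isScottOpen_apply_eq {A : P → L} (hA : e.IsScottOpen A) (x : P) :
    A x = ⨆ z, A z ⊓ e.wayBelow x z := hA.2 _ _ (he x).1 (he x).2

/-- The opens `x ↦ ⇓x(z)` suffice as tests: they carry `z ≪ x` to `z ≪ y`, hence `z ≤ y`, and `x` is
the supremum of such `z`. -/
theorem rel_eq_iInf (x y : P) : e.rel x y = ⨅ A : e.scottTopology.opens, A.1 x ⇨ A.1 y := by
  refine le_antisymm (le_iInf fun A => le_himp_iff.2 ?_) ?_
  · rw [inf_comm]
    exact A.2.1 x y
  · refine (isSup_iff.1 (he x).2).2 y _ fun z d hd hz => ?_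
    have h := hd.trans (iInf_le _ (⟨_, he.isScottOpen_wayBelow z⟩ : e.scottTopology.opens))
    exact (le_inf h hz).trans (himp_inf_le.trans (he.wayBelow_le_rel y z))

theorem isT0_scottTopology : e.scottTopology.IsT0 := by
  intro x y h
  refine e.rel_antisymm x y ?_
  rw [he.rel_eq_iInf, he.rel_eq_iInf, inf_eq_top_iff]
  simp only [iInf_eq_top, himp_eq_top_iff]
  exact ⟨fun A => (h A.1 A.2).le, fun A => (h A.1 A.2).ge⟩

theorem specializationOrder_scottTopology (h : e.scottTopology.IsT0) :
    e.scottTopology.specializationOrder h = e :=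
  LOrder.ext (funext fun x => funext fun y => (he.rel_eq_iInf x y).symm)

end IsContinuous

/-! ### Scott continuity versus topological continuity -/

/-! The next three lemmas allow the domain and the codomain to live in different universes. -/

theorem ScottContinuous.rel_le {Q : Type w} {e' : LOrder L Q} {f : P → Q}
    (hf : e.ScottContinuous e' f) : e.OrderPreserving e' f := by
  intro x y
  have hd : e.IsDirected (e.lower y) := by
    refine ⟨top_le_iff.1 ((e.rel_refl y).ge.trans (le_iSup (e.lower y) y)),
      fun a b => le_iSup_of_le y ?_⟩
    simp [lower, e.rel_refl]
  have hs : e.IsSup (e.lower y) y := isSup_iff.2 ⟨fun _ => le_rfl, fun t c hc =>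
    hc y c le_rfl ((e.rel_refl y).ge.trans' le_top)⟩
  exact (le_zadehImage f _ x).trans ((isSup_iff.1 (hf _ _ hd hs)).1 (f x))

theorem OrderPreserving.isDirected_zadehImage {Q : Type w} {e' : LOrder L Q} {f : P → Q}
    (hf : e.OrderPreserving e' f) {D : P → L} (hD : e.IsDirected D) :
    e'.IsDirected (zadehImage f D) := by
  constructor
  · simpa [hD.1] using iSup_zadehImage_inf f D ⊤
  · intro a b
    simp only [zadehImage, iSup_inf_eq, inf_iSup_eq]
    refine iSup₂_le fun y hy => iSup₂_le fun x hx => ?_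
    subst hx hy
    exact (hD.2 _ _).trans (iSup_le fun z => le_iSup_of_le (f z) (le_iSup₂_of_le z rfl
      (inf_le_inf (inf_le_inf le_rfl (hf _ _)) (hf _ _))))

theorem ScottContinuous.continuousMap_scottTopology {Q : Type w} {e' : LOrder L Q} {f : P → Q}
    (hf : e.ScottContinuous e' f) : e.scottTopology.ContinuousMap e'.scottTopology f := by
  refine fun B hB => ⟨fun x y => (inf_le_inf_left _ (hf.rel_le x y)).trans (hB.1 _ _),
    fun D s hD hs => (hB.2 _ _ (hf.rel_le.isDirected_zadehImage hD) (hf D s hD hs)).trans ?_⟩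
  simp only [inf_comm (B _), Function.comp_apply]
  exact iSup_zadehImage_inf f D B

/-- Continuity for the Scott `L`-topologies implies Scott continuity if the codomain is
continuous. -/
theorem scottContinuous_of_continuousMap {Q : Type w} {e' : LOrder L Q} (he' : e'.IsContinuous)
    {f : P → Q} (hf : e.scottTopology.ContinuousMap e'.scottTopology f) :
    e.ScottContinuous e' f := by
  intro D s hD hs t
  rw [lsub_zadehImage]
  -- Both halves compare points of `Q` through Scott opens, as continuity of `e'` permits, and pull
  -- these back along `f`.
  refine le_antisymm (le_lsub_iff.2 fun x d hd hx => ?_) ?_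
  · refine rel_trans_le (y := f s) ?_ hd
    rw [he'.rel_eq_iInf]
    refine le_iInf fun A => le_himp_iff.2 ?_
    refine le_trans (le_inf inf_le_right ?_) ((hf _ A.2).1 x s)
    exact inf_le_left.trans (hx.trans ((isSup_iff.1 hs).1 x))
  · rw [he'.rel_eq_iInf]
    refine le_iInf fun A => le_himp_iff.2 ?_
    have h : A.1 (f s) = ⨆ x, (A.1 ∘ f) x ⊓ D x := (hf _ A.2).2 D s hD hs
    rw [h]
    refine le_of_le_iSup inf_le_right fun x d hd hx => ?_
    have h1 : d ≤ e'.rel (f x) t := le_lsub_iff.1 (hd.trans inf_le_left) x d le_rfl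
      (hx.trans inf_le_right)
    exact (le_inf (hx.trans inf_le_left) h1).trans (A.2.1 _ _)

end LOrder

/-! ### Spaces of points, quasi-homeomorphisms and sobriety -/

namespace LTopology

variable {L : Type u} [Order.Frame L] {X : Type v} {τ : LTopology L X}

theorem iSup_mem {ι : Sort*} {A : ι → X → L} (h : ∀ i, A i ∈ τ.opens) :
    (fun x => ⨆ i, A i x) ∈ τ.opens := by
  have : (fun x => ⨆ i, A i x) = sSup (Set.range A) := by
    funext x
    rw [sSup_range, iSup_apply]
  rw [this]
  exact τ.sSup_mem (Set.range_subset_iff.2 h)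

theorem inf_const_mem {A : X → L} (h : A ∈ τ.opens) (a : L) : (fun x => a ⊓ A x) ∈ τ.opens :=
  τ.inf_mem (τ.const_mem a) h

theorem Point.toFun_injective : Function.Injective (Point.toFun (τ := τ)) := by
  rintro ⟨⟩ ⟨⟩ rfl
  rfl

namespace Point

variable (p : τ.Point)

theorem map_iSup {ι : Sort*} {A : ι → X → L} (h : ∀ i, A i ∈ τ.opens) :
    p.toFun ⟨_, iSup_mem h⟩ = ⨆ i, p.toFun ⟨A i, h i⟩ := by
  have h1 : (fun x => ⨆ i, A i x) = sSup (Set.range A) := by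
    funext x
    rw [sSup_range, iSup_apply]
  have h2 := p.map_sSup (Set.range A) (Set.range_subset_iff.2 h)
  simp only [h1, h2]
  refine le_antisymm (iSup_le fun B => ?_) (iSup_le fun i => ?_)
  · obtain ⟨B, i, rfl⟩ := B
    exact le_iSup (fun i => p.toFun ⟨A i, h i⟩) i
  · exact le_iSup (fun B : Set.range A => p.toFun ⟨B.1, Set.range_subset_iff.2 h B.2⟩)
      ⟨A i, i, rfl⟩

theorem map_const_inf {A : X → L} (h : A ∈ τ.opens) (a : L) :
    p.toFun ⟨_, inf_const_mem h a⟩ = a ⊓ p.toFun ⟨A, h⟩ :=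
  (p.map_inf ⟨_, τ.const_mem a⟩ ⟨A, h⟩).trans (by rw [p.map_const])

end Point

/-- The `L`-topology on the points of `𝒪(X)`. -/
def pointTopology (τ : LTopology L X) : LTopology L τ.Point where
  opens := Set.range fun (A : τ.opens) (p : τ.Point) => p.toFun A
  inf_mem := by
    rintro _ _ ⟨A, rfl⟩ ⟨B, rfl⟩
    exact ⟨⟨_, τ.inf_mem A.2 B.2⟩, funext fun p => p.map_inf A B⟩
  sSup_mem := by
    intro S hS
    choose F hF using hS
    refine ⟨⟨_, iSup_mem (A := fun B : S => (F B.2).1) fun B => (F B.2).2⟩, funext fun p => ?_⟩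
    simp only [p.map_iSup fun B : S => (F B.2).2, sSup_apply]
    exact iSup_congr fun B => congrFun (hF B.2) p
  const_mem a := ⟨⟨_, τ.const_mem a⟩, funext fun p => p.map_const a⟩

/-- A point of the space of points, as a point of the original space. -/
def Point.descend (q : τ.pointTopology.Point) : τ.Point where
  toFun A := q.toFun ⟨fun p => p.toFun A, A, rfl⟩
  map_inf A B := by
    rw [← q.map_inf]
    congr 2
    exact funext fun p => p.map_inf A B
  map_sSup S hS := by
    rw [← q.map_iSup (A := fun (A : S) (p : τ.Point) => p.toFun ⟨A.1, hS A.2⟩) fun A => ⟨_, rfl⟩]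
    congr 2
    exact funext fun p => p.map_sSup S hS
  map_const a := by
    refine Eq.trans ?_ (q.map_const a)
    congr 2
    exact funext fun p => p.map_const a

/-- Every open here is evaluation at some `A`, so a point `q` is determined by its values on these
evaluations, and those values form the point `q.descend`. -/
theorem isSober_pointTopology : τ.pointTopology.IsSober := by
  constructor
  · intro p q h
    exact Point.toFun_injective (funext fun A =>
      congrFun (congrArg Point.toFun h) ⟨fun p => p.toFun A, A, rfl⟩)
  · intro q
    refine ⟨q.descend, Point.toFun_injective (funext ?_)⟩
    rintro ⟨_, A, rfl⟩
    rfl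

/-- A continuous map that is bijective on open `L`-subsets. -/
structure IsQuasiHomeomorphism {Y : Type w} (τ : LTopology L X) (τ' : LTopology L Y)
    (j : X → Y) : Prop where
  continuousMap : τ.ContinuousMap τ' j
  injective : ∀ A ∈ τ'.opens, ∀ B ∈ τ'.opens, A ∘ j = B ∘ j → A = B
  surjective : ∀ C ∈ τ.opens, ∃ A ∈ τ'.opens, A ∘ j = C

theorem isQuasiHomeomorphism_evalPoint :
    IsQuasiHomeomorphism τ τ.pointTopology τ.evalPoint where
  continuousMap := by
    rintro _ ⟨A, rfl⟩
    exact A.2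
  injective := by
    rintro _ ⟨A, rfl⟩ _ ⟨B, rfl⟩ h
    have : A = B := Subtype.ext h
    rw [this]
  surjective C hC := ⟨_, ⟨⟨C, hC⟩, rfl⟩, rfl⟩

namespace IsQuasiHomeomorphism

variable {Y : Type w} {τ' : LTopology L Y} {j : X → Y}

/-- Only the composite `k ∘ h` has to be the identity, which is what uniqueness in the universal
property of `i` supplies. -/
theorem congr {Z : Type*} {τ'' : LTopology L Z} {i : X → Z} (hj : IsQuasiHomeomorphism τ τ' j)
    {h : Z → Y} {k : Y → Z} (hh : τ''.ContinuousMap τ' h) (hk : τ'.ContinuousMap τ'' k)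
    (hi : h ∘ i = j) (hkj : k ∘ j = i) (hkh : k ∘ h = id) : IsQuasiHomeomorphism τ τ'' i where
  continuousMap B hB := by
    rw [← hkj]
    exact hj.continuousMap _ (hk B hB)
  injective A hA B hB hAB := by
    have h1 : A ∘ k = B ∘ k := hj.injective _ (hk A hA) _ (hk B hB) (by
      simpa only [Function.comp_assoc, hkj] using hAB)
    have h2 : (A ∘ k) ∘ h = (B ∘ k) ∘ h := by rw [h1]
    simpa only [Function.comp_assoc, hkh, Function.comp_id] using h2
  surjective C hC := by
    obtain ⟨A, hA, rfl⟩ := hj.surjective C hC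
    exact ⟨A ∘ h, hh A hA, by rw [Function.comp_assoc, hi]⟩

/-- A quasi-homeomorphism is universal among continuous maps to `L`-sober spaces. -/
theorem existsUnique_lift (hj : IsQuasiHomeomorphism τ τ' j) {Z : Type*} {τ'' : LTopology L Z}
    (hZ : τ''.IsSober) {f : X → Z} (hf : τ.ContinuousMap τ'' f) :
    ∃! g : Y → Z, τ'.ContinuousMap τ'' g ∧ g ∘ j = f := by
  choose F hF hFj using fun C : τ''.opens => hj.surjective _ (hf C.1 C.2)
  -- `F C` is the only open extension of `C ∘ f` along `j`, so `F` preserves meets, joins and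
  -- constants; evaluation at `y` then gives a point, and sobriety turns it into `g y`.
  have hFeq : ∀ (C : τ''.opens) (A : Y → L), A ∈ τ'.opens → A ∘ j = C.1 ∘ f → F C = A :=
    fun C A hA h => hj.injective _ (hF C) _ hA ((hFj C).trans h.symm)
  let p : Y → τ''.Point := fun y =>
    { toFun C := F C y
      map_inf A B := by
        rw [hFeq _ _ (τ'.inf_mem (hF A) (hF B))]
        · rfl
        · funext x
          exact congrArg₂ (· ⊓ ·) (congrFun (hFj A) x) (congrFun (hFj B) x)
      map_sSup S hS := by
        rw [hFeq _ _ (iSup_mem fun A : S => hF ⟨A.1, hS A.2⟩)]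
        funext x
        simp only [Function.comp_apply, sSup_apply]
        exact iSup_congr fun A => congrFun (hFj ⟨A.1, hS A.2⟩) x
      map_const a := by rw [hFeq _ _ (τ'.const_mem a) rfl] }
  choose g hg using fun y => hZ.2 (p y)
  have hgF : ∀ C : τ''.opens, C.1 ∘ g = F C := fun C => funext fun y =>
    congrFun (congrArg Point.toFun (hg y)) C
  refine ⟨g, ⟨fun C hC => ?_, funext fun x => hZ.isT0 _ _ fun C hC => ?_⟩, ?_⟩
  · rw [hgF ⟨C, hC⟩]
    exact hF _
  · exact (congrFun (hgF ⟨C, hC⟩) (j x)).trans (congrFun (hFj ⟨C, hC⟩) x)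
  · rintro g' ⟨hg', hg'j⟩
    refine funext fun y => hZ.isT0 _ _ fun C hC => ?_
    have h1 := hFeq ⟨C, hC⟩ _ (hg' C hC) (by rw [Function.comp_assoc, hg'j])
    exact congrFun (h1.symm.trans (hgF ⟨C, hC⟩).symm) y

end IsQuasiHomeomorphism

/-- Directed `L`-subsets of an `L`-sober space have suprema, at which open `L`-subsets are
determined by their values on the directed `L`-subset. -/
theorem IsSober.exists_isSup (h : τ.IsSober) {D : X → L}
    (hD : (τ.specializationOrder h.isT0).IsDirected D) :
    ∃ s, (τ.specializationOrder h.isT0).IsSup D s ∧ ∀ A ∈ τ.opens, A s = ⨆ x, A x ⊓ D x := by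
  have hrel : ∀ A ∈ τ.opens, ∀ x y, A x ⊓ (τ.specializationOrder h.isT0).rel x y ≤ A y :=
    fun A hA x y => (inf_le_inf_left _ (iInf_le _ (⟨A, hA⟩ : τ.opens))).trans inf_himp_le
  -- Directedness of `D` is exactly what makes this a point: the join condition gives constants, the
  -- second condition binary meets. Its representative is the supremum.
  let p : τ.Point :=
    { toFun A := ⨆ x, A.1 x ⊓ D x
      map_inf A B := by
        refine le_antisymm (le_inf (iSup_mono fun x => inf_le_inf_right _ inf_le_left)
          (iSup_mono fun x => inf_le_inf_right _ inf_le_right)) ?_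
        refine le_of_le_iSup inf_le_left fun x c hc hx => ?_
        refine le_of_le_iSup (hc.trans inf_le_right) fun y d hd hy => ?_
        refine le_of_le_iSup (hD.le_iSup ((hd.trans hx).trans inf_le_right) (hy.trans inf_le_right))
          fun z g hg hz => le_iSup_of_le z (le_inf (le_inf ?_ ?_) ?_)
        · exact le_trans (le_inf ((hg.trans hd).trans (hx.trans inf_le_left))
            (hz.trans (inf_le_left.trans inf_le_right))) (hrel _ A.2 x z)
        · exact le_trans (le_inf (hg.trans (hy.trans inf_le_left)) (hz.trans inf_le_right))
            (hrel _ B.2 y z)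
        · exact hz.trans (inf_le_left.trans inf_le_left)
      map_sSup S hS := by
        simp only [sSup_apply, iSup_inf_eq]
        exact iSup_comm
      map_const a := by rw [← inf_iSup_eq, hD.1, inf_top_eq] }
  obtain ⟨s, hs⟩ := h.2 p
  have hs' : ∀ A ∈ τ.opens, A s = ⨆ x, A x ⊓ D x := fun A hA =>
    congrFun (congrArg Point.toFun hs) ⟨A, hA⟩
  refine ⟨s, LOrder.isSup_iff.2 ⟨fun x => le_iInf fun A => le_himp_iff.2 ?_,
    fun t c hc => le_iInf fun A => le_himp_iff.2 ?_⟩, hs'⟩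
  · rw [hs' _ A.2, inf_comm]
    exact le_iSup (fun x => A.1 x ⊓ D x) x
  · rw [hs' _ A.2]
    refine le_of_le_iSup inf_le_right fun x d hd hx => ?_
    exact (le_inf (hx.trans inf_le_left) (hc x d (hd.trans inf_le_left) (hx.trans inf_le_right))).trans
      (hrel _ A.2 x t)

end LTopology

/-! ### Sobriety of continuous `L`-dcpos -/

open LTopology in
/-- The Scott space of a continuous `L`-dcpo is `L`-sober. -/
theorem LOrder.IsContinuous.isSober_scottTopology {L : Type u} [Order.Frame L] {P : Type v}
    {e : LOrder L P} (he : e.IsContinuous) (hd : e.IsDcpo) : e.scottTopology.IsSober := by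
  constructor
  · exact fun x y h => he.isT0_scottTopology x y fun A hA =>
      congrFun (congrArg Point.toFun h) ⟨A, hA⟩
  · intro p
    let U : P → e.scottTopology.opens := fun y => ⟨_, he.isScottOpen_wayBelow y⟩
    -- A point is determined by its values on the basis `U`; these values form a directed
    -- `L`-subset, whose supremum represents `p`.
    have hp : ∀ A (hA : A ∈ e.scottTopology.opens),
        p.toFun ⟨A, hA⟩ = ⨆ z, A z ⊓ p.toFun (U z) := by
      intro A hA
      simp only [U, ← p.map_const_inf (he.isScottOpen_wayBelow _)]
      rw [← p.map_iSup fun z => inf_const_mem (he.isScottOpen_wayBelow z) (A z)]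
      congr 2
      exact funext fun x => he.isScottOpen_apply_eq hA x
    have hD : e.IsDirected fun y => p.toFun (U y) := by
      constructor
      · have := hp _ (e.scottTopology.const_mem ⊤)
        rw [p.map_const] at this
        simpa using this.symm
      · intro x y
        rw [← p.map_inf, hp]
        refine iSup_mono fun z => le_inf (le_inf inf_le_right ?_) ?_
        · exact inf_le_left.trans (inf_le_left.trans (he.wayBelow_le_rel z x))
        · exact inf_le_left.trans (inf_le_right.trans (he.wayBelow_le_rel z y))
    obtain ⟨s, hs⟩ := hd _ hD
    refine ⟨s, Point.toFun_injective (funext fun A => ?_)⟩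
    exact (A.2.2 _ _ hD hs).trans (hp A.1 A.2).symm

/-! ### Quasi-homeomorphisms out of the Scott space of a continuous `L`-ordered set -/

namespace LTopology.IsQuasiHomeomorphism

variable {L : Type u} [Order.Frame L] {P : Type v} {Y : Type w} {e : LOrder L P}
  {τ : LTopology L Y} {j : P → Y}

/-- `W z` extends the basic open `x ↦ ⇓x(z)` along `j`. The basis expansion holds after restriction
to `P`, hence on `Y` by injectivity on opens. -/
theorem exists_basis (he : e.IsContinuous) (hj : IsQuasiHomeomorphism e.scottTopology τ j) :
    ∃ W : P → Y → L, (∀ z, W z ∈ τ.opens) ∧ (∀ z x, W z (j x) = e.wayBelow x z) ∧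
      ∀ A ∈ τ.opens, ∀ y, A y = ⨆ z, A (j z) ⊓ W z y := by
  choose W hW hWj using fun z => hj.surjective _ (he.isScottOpen_wayBelow z)
  refine ⟨W, hW, fun z x => congrFun (hWj z) x, fun A hA => congrFun ?_⟩
  refine hj.injective _ hA _ (iSup_mem fun z => inf_const_mem (hW z) (A (j z))) (funext fun x => ?_)
  refine (he.isScottOpen_apply_eq (hj.continuousMap A hA) x).trans (iSup_congr fun z => ?_)
  exact congrArg (A (j z) ⊓ ·) (congrFun (hWj z) x).symm

/-- Principal upper sets are super-compact, since inclusion of `↑j(z)` in an open `V` has degree `V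
(j z)`; and `W z` lies in the interior of `↑j(z)`. -/
theorem isLocallySuperCompact (he : e.IsContinuous)
    (hj : IsQuasiHomeomorphism e.scottTopology τ j) : τ.IsLocallySuperCompact := by
  obtain ⟨W, hW, -, hWA⟩ := hj.exists_basis he
  intro A hA y
  refine le_antisymm ?_ (iSup₂_le fun B _ => ?_)
  · rw [hWA A hA y]
    refine iSup_le fun z => ?_
    let B : Y → L := fun y => ⨅ A : τ.opens, A.1 (j z) ⇨ A.1 y
    have hB : B (j z) = ⊤ := by simp [B]
    have hsub : ∀ V ∈ τ.opens, lsub B V = V (j z) := by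
      intro V hV
      refine le_antisymm ?_ (le_lsub_iff.2 fun x d hd hx => ?_)
      · exact le_lsub_iff.1 le_rfl (j z) _ le_rfl (hB ▸ le_top)
      · exact (le_inf hd (hx.trans (iInf_le _ (⟨V, hV⟩ : τ.opens)))).trans inf_himp_le
    refine le_iSup₂_of_le B ⟨top_le_iff.1 (hB ▸ le_iSup B (j z)), fun S hS => ?_⟩ ?_
    · rw [hsub _ (τ.sSup_mem hS), sSup_apply]
      exact iSup_congr fun V => (hsub _ (hS V.2)).symm
    · rw [hsub A hA]
      refine inf_le_inf_left _ ((le_sSup (α := Y → L) ⟨hW z, fun y => ?_⟩ : W z ≤ τ.interior B) y)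
      refine le_iInf fun V => le_himp_iff.2 ?_
      rw [hWA V.1 V.2 y, inf_comm]
      exact le_iSup (fun z => V.1 (j z) ⊓ W z y) z
  · have h : τ.interior B ≤ B := sSup_le fun _ h => h.2
    exact (inf_le_inf_left _ (h y)).trans (le_lsub_iff.1 inf_le_left y _ le_rfl inf_le_right)

/-- A sobrification of the Scott space of a continuous `L`-ordered set is, with its specialization
`L`-order, a continuous `L`-dcpo, and its `L`-topology is the Scott `L`-topology. -/
theorem specializationOrder (he : e.IsContinuous)
    (hj : IsQuasiHomeomorphism e.scottTopology τ j) (h : τ.IsSober) :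
    ((τ.specializationOrder h.isT0).IsContinuous ∧ (τ.specializationOrder h.isT0).IsDcpo) ∧
      (τ.specializationOrder h.isT0).scottTopology = τ := by
  obtain ⟨W, hW, hWj, hWA⟩ := hj.exists_basis he
  let r := τ.specializationOrder h.isT0
  have hrel : ∀ A ∈ τ.opens, ∀ x y, A x ⊓ r.rel x y ≤ A y :=
    fun A hA x y => (inf_le_inf_left _ (iInf_le _ (⟨A, hA⟩ : τ.opens))).trans inf_himp_le
  have hWr : ∀ z y, W z y ≤ r.rel (j z) y := fun z y => le_iInf fun A => le_himp_iff.2 (by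
    rw [hWA A.1 A.2 y, inf_comm]
    exact le_iSup (fun z => A.1 (j z) ⊓ W z y) z)
  -- By uniqueness of suprema, `s` is the one provided by sobriety, where opens are computed on `D`.
  have hopen : ∀ A ∈ τ.opens, r.IsScottOpen A := fun A hA => ⟨hrel A hA, fun D s hD hs => by
    obtain ⟨t, ht, htA⟩ := h.exists_isSup hD
    rw [hs.unique ht, htA A hA]⟩
  -- This image of `P` approximates `y` from way below. Its directedness comes from expanding `W a'
  -- ⊓ W b'` in the basis.
  have hdir : ∀ y, r.IsDirected (zadehImage j fun z => W z y) := by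
    intro y
    constructor
    · have h1 := iSup_zadehImage_inf j (fun z => W z y) ⊤
      have h2 := hWA _ (τ.const_mem ⊤) y
      simp only [top_inf_eq, Pi.top_apply, inf_top_eq] at h1 h2
      rw [h1, ← h2]
    · intro a b
      simp only [zadehImage, iSup_inf_eq, inf_iSup_eq]
      refine iSup₂_le fun b' hb => iSup₂_le fun a' ha => ?_
      subst ha hb
      refine ((hWA _ (τ.inf_mem (hW a') (hW b')) y).le).trans (iSup_le fun z => ?_)
      refine le_iSup_of_le (j z) (le_iSup₂_of_le z rfl (le_inf (le_inf inf_le_right ?_) ?_))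
      · exact inf_le_left.trans (inf_le_left.trans (hWr _ _))
      · exact inf_le_left.trans (inf_le_right.trans (hWr _ _))
  have hsup : ∀ y, r.IsSup (zadehImage j fun z => W z y) y := by
    intro y t
    rw [lsub_zadehImage]
    refine le_antisymm (le_lsub_iff.2 fun z d hd hz => ?_) (le_iInf fun A => le_himp_iff.2 ?_)
    · exact LOrder.rel_trans_le (hz.trans (hWr z y)) hd
    · rw [hWA A.1 A.2 y]
      refine le_of_le_iSup inf_le_right fun z d hd hz => ?_
      exact (le_inf (hz.trans inf_le_left) (le_lsub_iff.1 (hd.trans inf_le_left) z d le_rfl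
        (hz.trans inf_le_right))).trans (hrel _ A.2 (j z) t)
  refine ⟨⟨fun y => LOrder.isDirected_wayBelow_of_le (hdir y) (hsup y) fun q => ?_,
    fun D hD => (h.exists_isSup hD).imp fun s hs => hs.1⟩, LTopology.ext (Set.ext fun A =>
      ⟨fun hA => ?_, hopen A⟩)⟩
  -- `W z` is Scott open and lies inside `↑j(z)`, so once it contains `⊔D` it meets `D` above `j z`.
  · refine iSup₂_le fun z hz => LOrder.le_wayBelow fun D s hD hs d hd hds => ?_
    subst hz
    have h1 : d ≤ W z s := (le_inf hd hds).trans (hrel _ (hW z) y s)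
    rw [(hopen _ (hW z)).2 D s hD hs] at h1
    refine h1.trans (iSup_mono fun x => le_inf inf_le_right (inf_le_left.trans (hWr z x)))
  -- Scott openness, applied to the approximating directed `L`-subset of each `y`, writes `A` as a
  -- join of `τ`-opens.
  · have : A = fun y => ⨆ z, A (j z) ⊓ W z y := by
      funext y
      rw [hA.2 _ _ (hdir y) (hsup y)]
      simp only [inf_comm (A _)]
      exact iSup_zadehImage_inf j _ A
    rw [this]
    exact iSup_mem fun z => inf_const_mem (hW z) (A (j z))

end LTopology.IsQuasiHomeomorphism

/-! ### Both universal properties in terms of quasi-homeomorphisms -/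

section Completions

open LTopology

variable {L : Type u} [Order.Frame L] {P : Type v}

/-- A universal `j` is compared with the space of points, which lives in the universe of the test
objects. The two lifts compose to the identity of `Y` by uniqueness. -/
theorem isLSobrification_iff {τ : LTopology L P} {Y : LSob.{u, max u v} L} :
    IsLSobrification τ Y ↔ ∃ j, IsQuasiHomeomorphism τ Y.obj.topology j := by
  constructor
  · rintro ⟨j, hj, huniv⟩
    have h0 := isQuasiHomeomorphism_evalPoint (τ := τ)
    obtain ⟨h, ⟨hh, hhj⟩, -⟩ := huniv ⟨⟨τ.Point, τ.pointTopology⟩, isSober_pointTopology⟩ _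
      h0.continuousMap
    obtain ⟨k, ⟨hk, hkj⟩, -⟩ := h0.existsUnique_lift Y.property hj
    refine ⟨j, h0.congr hh hk hhj hkj ?_⟩
    exact (huniv Y j hj).unique ⟨fun B hB => hh _ (hk B hB), by
      rw [Function.comp_assoc, hhj, hkj]⟩ ⟨fun B hB => hB, rfl⟩
  · rintro ⟨j, hj⟩
    exact ⟨j, hj.continuousMap, fun Z f hf => hj.existsUnique_lift Z.property hf⟩

variable {e : LOrder L P}

theorem isDirectedCompletion_of_isQuasiHomeomorphism {Q : CDom.{u, w} L} {j : P → Q.obj.carrier}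
    (hj : IsQuasiHomeomorphism e.scottTopology Q.obj.order.scottTopology j) :
    IsDirectedCompletion e Q := by
  refine ⟨j, LOrder.scottContinuous_of_continuousMap Q.property.1 hj.continuousMap,
    fun M f hf => ?_⟩
  obtain ⟨g, ⟨hg, hgj⟩, huniq⟩ := hj.existsUnique_lift
    (M.property.1.isSober_scottTopology M.property.2) hf.continuousMap_scottTopology
  exact ⟨g, ⟨LOrder.scottContinuous_of_continuousMap M.property.1 hg, hgj⟩,
    fun g' hg' => huniq g' ⟨hg'.1.continuousMap, hg'.2⟩⟩

/-- Same comparison as for sobrifications: the space of points of `σ_L(P)`, with its specialization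
order, is a continuous `L`-dcpo. -/
theorem isDirectedCompletion_iff (he : e.IsContinuous) {Q : CDom.{u, max u v} L} :
    IsDirectedCompletion e Q ↔
      ∃ j, IsQuasiHomeomorphism e.scottTopology Q.obj.order.scottTopology j := by
  refine ⟨?_, fun ⟨j, hj⟩ => isDirectedCompletion_of_isQuasiHomeomorphism hj⟩
  rintro ⟨j, hj, huniv⟩
  have h0 := isQuasiHomeomorphism_evalPoint (τ := e.scottTopology)
  obtain ⟨hprop, htop⟩ := h0.specializationOrder he isSober_pointTopology
  -- The point topology is now seen as a Scott topology, so continuous maps into it become Scott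
  -- continuous.
  rw [← htop] at h0
  obtain ⟨h, ⟨hh, hhj⟩, -⟩ := huniv ⟨⟨_, _⟩, hprop⟩ _
    (LOrder.scottContinuous_of_continuousMap hprop.1 h0.continuousMap)
  obtain ⟨k, ⟨hk, hkj⟩, -⟩ := h0.existsUnique_lift
    (Q.property.1.isSober_scottTopology Q.property.2) hj.continuousMap_scottTopology
  refine ⟨j, h0.congr hh.continuousMap hk hhj hkj ?_⟩
  exact (huniv Q j hj).unique
    ⟨(LOrder.scottContinuous_of_continuousMap Q.property.1 hk).comp hh, by
      rw [Function.comp_assoc, hhj, hkj]⟩ ⟨LOrder.ScottContinuous.id _, rfl⟩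

/-! ### The restricted functors and their composites -/

/-- The restriction of `Σ_L` to directed completions. -/
def sigmaCompletions (he : e.IsContinuous) :
    DirectedCompletions e ⥤ LSobrifications e.scottTopology where
  obj Q := ⟨⟨⟨Q.obj.obj.carrier, Q.obj.obj.order.scottTopology⟩,
    Q.obj.property.1.isSober_scottTopology Q.obj.property.2⟩,
    isLSobrification_iff.2 ((isDirectedCompletion_iff he).1 Q.property)⟩
  map f := ⟨⟨⟨f.hom.hom.toFun, f.hom.hom.prop.continuousMap⟩⟩⟩

theorem specializationOrder_of_isLSobrification (he : e.IsContinuous)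
    {Y : LSob.{u, max u v} L} (hY : IsLSobrification e.scottTopology Y) :
    ((Y.obj.topology.specializationOrder Y.property.isT0).IsContinuous ∧
      (Y.obj.topology.specializationOrder Y.property.isT0).IsDcpo) ∧
      (Y.obj.topology.specializationOrder Y.property.isT0).scottTopology = Y.obj.topology := by
  obtain ⟨j, hj⟩ := isLSobrification_iff.1 hY
  exact hj.specializationOrder he Y.property

/-- The restriction of `Ω_L` to `L`-sobrifications. -/
def omegaSobrifications (he : e.IsContinuous) :
    LSobrifications e.scottTopology ⥤ DirectedCompletions e where
  obj Y := ⟨⟨⟨Y.obj.obj.carrier, Y.obj.obj.topology.specializationOrder Y.obj.property.isT0⟩,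
    (specializationOrder_of_isLSobrification he Y.property).1⟩, by
      obtain ⟨j, hj⟩ := isLSobrification_iff.1 Y.property
      refine isDirectedCompletion_of_isQuasiHomeomorphism (j := j) ?_
      change IsQuasiHomeomorphism e.scottTopology
        (Y.obj.obj.topology.specializationOrder Y.obj.property.isT0).scottTopology j
      rwa [(specializationOrder_of_isLSobrification he Y.property).2]⟩
  map {Y Z} f := ⟨⟨⟨f.hom.hom.toFun, by
    refine LOrder.scottContinuous_of_continuousMap
      (specializationOrder_of_isLSobrification he Z.property).1.1 ?_
    change LTopology.ContinuousMap
      (Y.obj.obj.topology.specializationOrder Y.obj.property.isT0).scottTopology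
      (Z.obj.obj.topology.specializationOrder Z.obj.property.isT0).scottTopology f.hom.hom.toFun
    rw [(specializationOrder_of_isLSobrification he Y.property).2,
      (specializationOrder_of_isLSobrification he Z.property).2]
    exact f.hom.hom.prop⟩⟩⟩

/-- A round trip fixes the carrier definitionally but the order only up to a proved equality.
Keeping carriers fixed lets that equality be substituted. -/
theorem LPosScott.hom_heq {A B : Type w} {a a' : LOrder L A} {b b' : LOrder L B} (ha : a = a')
    (hb : b = b') {p : ObjectProperty (LPosScott.{u, w} L)} {q : ObjectProperty p.FullSubcategory}
    {h1 h2 h1' h2'} {k1 k2 k1' k2'}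
    (f : (⟨⟨⟨A, a⟩, h1⟩, k1⟩ : q.FullSubcategory) ⟶ ⟨⟨⟨B, b⟩, h2⟩, k2⟩)
    (g : (⟨⟨⟨A, a'⟩, h1'⟩, k1'⟩ : q.FullSubcategory) ⟶ ⟨⟨⟨B, b'⟩, h2'⟩, k2'⟩)
    (hfg : f.hom.hom.toFun = g.hom.hom.toFun) : HEq f g := by
  subst ha hb
  refine heq_of_eq ?_
  obtain ⟨⟨⟨f, _⟩⟩⟩ := f
  obtain ⟨⟨⟨g, _⟩⟩⟩ := g
  cases hfg
  rfl

theorem LTopCat.hom_heq {A B : Type w} {a a' : LTopology L A} {b b' : LTopology L B} (ha : a = a')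
    (hb : b = b') {p : ObjectProperty (LTopCat.{u, w} L)} {q : ObjectProperty p.FullSubcategory}
    {h1 h2 h1' h2'} {k1 k2 k1' k2'}
    (f : (⟨⟨⟨A, a⟩, h1⟩, k1⟩ : q.FullSubcategory) ⟶ ⟨⟨⟨B, b⟩, h2⟩, k2⟩)
    (g : (⟨⟨⟨A, a'⟩, h1'⟩, k1'⟩ : q.FullSubcategory) ⟶ ⟨⟨⟨B, b'⟩, h2'⟩, k2'⟩)
    (hfg : f.hom.hom.toFun = g.hom.hom.toFun) : HEq f g := by
  subst ha hb
  refine heq_of_eq ?_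
  obtain ⟨⟨⟨f, _⟩⟩⟩ := f
  obtain ⟨⟨⟨g, _⟩⟩⟩ := g
  cases hfg
  rfl

theorem sigmaCompletions_comp_omegaSobrifications (he : e.IsContinuous) :
    sigmaCompletions he ⋙ omegaSobrifications he = 𝟭 (DirectedCompletions e) := by
  have h : ∀ Q : DirectedCompletions e,
      ((sigmaCompletions he).obj Q).obj.obj.topology.specializationOrder
        ((sigmaCompletions he).obj Q).obj.property.isT0 = Q.obj.obj.order := fun Q =>
    Q.obj.property.1.specializationOrder_scottTopology _
  refine Functor.hext (fun Q => ?_) fun Q R f => LPosScott.hom_heq (h Q) (h R) _ _ rfl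
  refine ObjectProperty.FullSubcategory.ext (ObjectProperty.FullSubcategory.ext ?_)
  exact congrArg (LPosScott.mk Q.obj.obj.carrier) (h Q)

theorem omegaSobrifications_comp_sigmaCompletions (he : e.IsContinuous) :
    omegaSobrifications he ⋙ sigmaCompletions he = 𝟭 (LSobrifications e.scottTopology) := by
  have h : ∀ Y : LSobrifications e.scottTopology,
      ((omegaSobrifications he).obj Y).obj.obj.order.scottTopology = Y.obj.obj.topology := fun Y =>
    (specializationOrder_of_isLSobrification he Y.property).2
  refine Functor.hext (fun Y => ?_) fun Y Z f => LTopCat.hom_heq (h Y) (h Z) _ _ rfl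
  refine ObjectProperty.FullSubcategory.ext (ObjectProperty.FullSubcategory.ext ?_)
  exact congrArg (LTopCat.mk Y.obj.obj.carrier) (h Y)

end Completions

/-- The functors `Σ_L` and `Ω_L` restrict to mutually inverse functors between the category of
directed completions of a continuous `L`-ordered set and the category of `L`-sobrifications of its
Scott space; moreover all these `L`-sobrifications are locally super-compact. -/
theorem mainTheorem5 {L : Type u} [Order.Frame L] {P : Type v} (e : LOrder L P)
    (he : e.IsContinuous) :
    (∃ (S : DirectedCompletions e ⥤ LSobrifications e.scottTopology)
       (O : LSobrifications e.scottTopology ⥤ DirectedCompletions e),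
      S ⋙ LSobrifications.incl e.scottTopology ⋙ LSob.incl L =
          DirectedCompletions.incl e ⋙ CDom.incl L ⋙ sigmaL L ∧
        O ⋙ DirectedCompletions.incl e ⋙ CDom.incl L ⋙ LPosScott.toMono L =
          LSobrifications.incl e.scottTopology ⋙ LSob.toT0 L ⋙ omegaL L ∧
        S ⋙ O = 𝟭 (DirectedCompletions e) ∧
        O ⋙ S = 𝟭 (LSobrifications e.scottTopology)) ∧
    ∀ Y : LSobrifications e.scottTopology, Y.obj.obj.topology.IsLocallySuperCompact := by
  -- Agreement with `Σ_L` and `Ω_L` is definitional, because the restrictions use the same carriers,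
  -- structures and maps.
  refine ⟨⟨sigmaCompletions he, omegaSobrifications he, rfl, rfl,
    sigmaCompletions_comp_omegaSobrifications he, omegaSobrifications_comp_sigmaCompletions he⟩,
    fun Y => ?_⟩
  obtain ⟨j, hj⟩ := isLSobrification_iff.1 Y.property
  exact hj.isLocallySuperCompact he
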